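/- **Corollary.** Let $M$ be a smooth manifold (finite-dimensional, Hausdorff, second countable, without boundary, not necessarily connected), regarded as a diffeological space with its standard diffeology, whose plots are the smooth maps $U \to M$ in the usual sense. Then $M$ is fibrant, that is, its smooth singular simplicial set $S^D(M)$ is a Kan complex. Here $S^D(M)$ is the simplicial set with $S^D_n(M) = C^\infty(\mathbb{A}^n, M)$, where $\mathbb{A}^n = \{(x_0,\dots,x_n) \in \mathbb{R}^{n+1} : \sum_i x_i = 1\}$ carries the sub-diffeology from $\mathbb{R}^{n+1}$ and a map $f : [m] \to [n]$ in the simplex category acts by precomposition with the affine map $f_* : \mathbb{A}^m \to \mathbb{A}^n$, $(f_* x)_j = \sum_{f(i) = j} x_i$. -/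

import Mathlib

open CategoryTheory Diffeology
open scoped Manifold ContDiff TypeCat

universe u

noncomputable section

/-- The largest diffeology on `A` making `f : A → X` smooth: a map into `A` is a plot iff its
composition with `f` is a plot of `X`. For the inclusion of a subset this is the sub-diffeology. -/
@[reducible]
def DiffeologicalSpace.pullback {A X : Type*} [DiffeologicalSpace X] (f : A → X) :
    DiffeologicalSpace A where
  plots _ := {p | IsPlot (f ∘ p)}
  constant_plots x := isPlot_const (x := f x)
  plot_reparam hp hg := isPlot_reparam (X := X) hp hg
  locality {n p} hp := DiffeologicalSpace.locality (X := X) (n := n) (p := f ∘ p) fun x ↦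
    let ⟨u, hu, hxu, h⟩ := hp x
    ⟨u, hu, hxu, fun hg hg' ↦ h hg hg'⟩

/-- The standard diffeology on a smooth manifold: the plots are the smooth maps in the usual
sense. -/
@[reducible]
def ModelWithCorners.diffeology {E : Type*} [NormedAddCommGroup E] [NormedSpace ℝ E]
    {H : Type*} [TopologicalSpace H] (I : ModelWithCorners ℝ E H)
    (M : Type*) [TopologicalSpace M] [ChartedSpace H M] : DiffeologicalSpace M :=
  .ofCorePlotsOn {
    isPlotOn := fun {n u} _ p ↦ ContMDiffOn 𝓘(ℝ, EuclideanSpace ℝ (Fin n)) I ∞ p u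
    isPlotOn_congr := fun _ _ _ h ↦ contMDiffOn_congr h
    isPlot := fun {n} p ↦ ContMDiff 𝓘(ℝ, EuclideanSpace ℝ (Fin n)) I ∞ p
    isPlotOn_univ := contMDiffOn_univ
    isPlot_const := fun _ ↦ contMDiff_const
    isPlotOn_reparam := fun _ _ _ h hp hf ↦ hp.comp hf.contMDiffOn h
    locality := fun _ _ h x hxu ↦
      let ⟨_, hv, hxv, hv'⟩ := h x hxu
      ((hv' x hxv).contMDiffAt (hv.mem_nhds hxv)).contMDiffWithinAt }

/-- The affine simplex `𝔸ⁿ = {x ∈ ℝⁿ⁺¹ | ∑ xᵢ = 1}` (no sign condition on the coordinates). -/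
def AffineSimplex (n : SimplexCategory) : Type :=
  {x : EuclideanSpace ℝ (Fin (n.len + 1)) // ∑ i, x i = 1}

namespace AffineSimplex

/-- `𝔸ⁿ` carries the sub-diffeology from `ℝⁿ⁺¹`. -/
instance (n : SimplexCategory) : DiffeologicalSpace (AffineSimplex n) :=
  .pullback (fun x : AffineSimplex n ↦ x.1)

/-- The affine map `𝔸ⁿ → 𝔸ᵐ` induced by a monotone map `f : [n] → [m]`; it sends the vertex `eᵢ`
to the vertex `e_{f i}`. -/
def map {n m : SimplexCategory} (f : n ⟶ m) (x : AffineSimplex n) : AffineSimplex m :=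
  ⟨WithLp.toLp 2 fun j ↦ ∑ i, if f i = j then x.1 i else 0, by
    have h := x.2
    simp only
    rw [Finset.sum_comm]
    simpa using h⟩

lemma map_apply {n m : SimplexCategory} (f : n ⟶ m) (x : AffineSimplex n)
    (j : Fin (m.len + 1)) : (map f x).1 j = ∑ i, if f i = j then x.1 i else 0 := rfl

lemma map_id (n : SimplexCategory) : map (𝟙 n) = id := by
  funext x
  apply Subtype.ext
  ext j
  rw [map_apply]
  simp

lemma map_comp {n m k : SimplexCategory} (f : n ⟶ m) (g : m ⟶ k) :
    map (f ≫ g) = map g ∘ map f := by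
  funext x
  apply Subtype.ext
  ext j
  have h (b : Fin (m.len + 1)) : (if g b = j then ∑ i, if f i = b then x.1 i else 0 else 0) =
      ∑ i, if f i = b then (if g (f i) = j then x.1 i else 0) else 0 := by
    split_ifs with hb
    · refine Finset.sum_congr rfl fun i _ ↦ ?_
      split_ifs <;> simp_all
    · refine (Finset.sum_eq_zero fun i _ ↦ ?_).symm
      split_ifs <;> simp_all
  simp only [Function.comp_apply, map_apply, h]
  rw [Finset.sum_comm]
  simp

lemma dSmooth_map {n m : SimplexCategory} (f : n ⟶ m) : DSmooth (map f) := by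
  intro k p hp
  have hp' : ContDiff ℝ ∞ fun y ↦ (p y).1 := hp
  change ContDiff ℝ ∞ fun y ↦ (map f (p y)).1
  rw [contDiff_euclidean] at hp' ⊢
  intro j
  simp only [map_apply]
  refine ContDiff.sum fun i _ ↦ ?_
  split_ifs
  · exact hp' i
  · exact contDiff_const

end AffineSimplex

/-- The smooth singular simplicial set `S^D(X)`: its `n`-simplices are the smooth maps `𝔸ⁿ → X`,
and `f : [n] → [m]` acts by precomposition with the induced map `𝔸ⁿ → 𝔸ᵐ`. -/
def smoothSing (X : Type u) [DiffeologicalSpace X] : SSet.{u} where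
  obj n := {σ : AffineSimplex n.unop → X // DSmooth σ}
  map f := ↾fun σ ↦ ⟨σ.1 ∘ AffineSimplex.map f.unop, σ.2.comp (AffineSimplex.dSmooth_map f.unop)⟩
  map_id n := by
    ext σ x
    simp [AffineSimplex.map_id]
  map_comp f g := by
    ext σ x
    simp [AffineSimplex.map_comp, Function.comp_assoc]

/-- A diffeological space is fibrant if its smooth singular simplicial set is a Kan complex. -/
def DiffeologicalSpace.IsFibrant {X : Type u} (_ : DiffeologicalSpace X) : Prop :=
  SSet.KanComplex (smoothSing X)

end

/-!
A horn in `S^D(M)` is a family of smooth maps on faces of an affine simplex. Composed with affine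
retractions these become maps on a vector space, and the problem is to find a smooth map `F` on
`ℝⁿ⁺²` with prescribed restrictions to the coordinate hyperplanes `v_j = 0`, `j ≠ k`.

If the target is a vector space, inclusion–exclusion over the commuting coordinate projections gives
such an `F`. In a manifold the same formula, read in a chart, extends the data near each point of
the union `X` of the hyperplanes. Two extensions near a point of `X` agree there on `X`, hence take
values in a convex part of a chart, where a cutoff function interpolates between them without
changing them on `X`; passing along a compact exhaustion yields an extension `g` to a neighbourhood
of `X`. Finally `X` is star-shaped about `0`, so for a suitable cutoff function `a` with `a = 1` on
`X` the map `v ↦ a v • v` sends the whole space into that neighbourhood, and `F v = g (a v • v)`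
works.
-/

section ChartInterpolation

open Set Topology Filter

variable {E : Type*} [NormedAddCommGroup E] [NormedSpace ℝ E]
  {H : Type*} [TopologicalSpace H] (I : ModelWithCorners ℝ E H)
  {M : Type*} [TopologicalSpace M] [ChartedSpace H M] {N : Type*}

/-- The maps `g₀` and `g` interpolated affinely in the extended chart at `p`, with parameter `ρ`.
The value is meaningful only where the interpolation stays in the target of the chart. -/
noncomputable def chartInterpolation (p : M) (ρ : N → ℝ) (g₀ g : N → M) (y : N) : M :=
  (extChartAt I p).symm (AffineMap.lineMap (extChartAt I p (g₀ y)) (extChartAt I p (g y)) (ρ y))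

variable {I} {p : M} {ρ : N → ℝ} {g₀ g : N → M} {y : N}

lemma chartInterpolation_of_eq_zero (hρ : ρ y = 0) (hy : g₀ y ∈ (extChartAt I p).source) :
    chartInterpolation I p ρ g₀ g y = g₀ y := by
  rw [chartInterpolation, hρ, AffineMap.lineMap_apply_zero, (extChartAt I p).left_inv hy]

lemma chartInterpolation_of_eq_one (hρ : ρ y = 1) (hy : g y ∈ (extChartAt I p).source) :
    chartInterpolation I p ρ g₀ g y = g y := by
  rw [chartInterpolation, hρ, AffineMap.lineMap_apply_one, (extChartAt I p).left_inv hy]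

lemma chartInterpolation_of_eq (h : g₀ y = g y) (hy : g y ∈ (extChartAt I p).source) :
    chartInterpolation I p ρ g₀ g y = g y := by
  rw [chartInterpolation, h, AffineMap.lineMap_same_apply, (extChartAt I p).left_inv hy]

lemma extChartAt_target_mem_nhds_of_boundaryless [BoundarylessManifold I M] (p : M) :
    (extChartAt I p).target ∈ 𝓝 (extChartAt I p p) :=
  mem_interior_iff_mem_nhds.1 <|
    ModelWithCorners.isInteriorPoint_iff.1 (BoundarylessManifold.isInteriorPoint (I := I))

lemma exists_isOpen_convex_subset_extChartAt_target [BoundarylessManifold I M] (p : M) :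
    ∃ B : Set E, IsOpen B ∧ Convex ℝ B ∧ extChartAt I p p ∈ B ∧ B ⊆ (extChartAt I p).target := by
  obtain ⟨r, hr, hball⟩ :=
    Metric.mem_nhds_iff.1 (extChartAt_target_mem_nhds_of_boundaryless (I := I) p)
  exact ⟨_, Metric.isOpen_ball, convex_ball _ r, Metric.mem_ball_self hr, hball⟩

lemma contMDiffAt_chartInterpolation {E' : Type*} [NormedAddCommGroup E'] [NormedSpace ℝ E']
    {H' : Type*} [TopologicalSpace H'] {J : ModelWithCorners ℝ E' H'}
    [TopologicalSpace N] [ChartedSpace H' N] {n : WithTop ℕ∞} [IsManifold I n M] {B : Set E}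
    (hB : IsOpen B) (hBconvex : Convex ℝ B) (hBtarget : B ⊆ (extChartAt I p).target)
    (hρ : ContMDiffAt J 𝓘(ℝ) n ρ y) (hρ01 : ρ y ∈ Icc (0 : ℝ) 1)
    (hg₀ : ContMDiffAt J I n g₀ y) (hg : ContMDiffAt J I n g y)
    (hg₀y : g₀ y ∈ (extChartAt I p).source ∩ extChartAt I p ⁻¹' B)
    (hgy : g y ∈ (extChartAt I p).source ∩ extChartAt I p ⁻¹' B) :
    ContMDiffAt J I n (chartInterpolation I p ρ g₀ g) y := by
  rw [extChartAt_source] at hg₀y hgy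
  have hφg₀ := (contMDiffAt_extChartAt' (n := n) hg₀y.1).comp y hg₀
  have hφg := (contMDiffAt_extChartAt' (n := n) hgy.1).comp y hg
  have hline : ContMDiffAt J 𝓘(ℝ, E) n
      (fun z ↦ AffineMap.lineMap (extChartAt I p (g₀ z)) (extChartAt I p (g z)) (ρ z)) y := by
    simp only [AffineMap.lineMap_apply_module']
    exact (hρ.smul (hφg.sub hφg₀)).add hφg₀
  have hmem : AffineMap.lineMap (extChartAt I p (g₀ y)) (extChartAt I p (g y)) (ρ y) ∈ B :=
    hBconvex.lineMap_mem hg₀y.2 hgy.2 hρ01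
  have hsymm := (contMDiffOn_extChartAt_symm (n := n) p).contMDiffAt
    (mem_of_superset (hB.mem_nhds hmem) hBtarget)
  exact hsymm.comp y hline

end ChartInterpolation

section SmoothExtension

open Set Topology Filter

variable {E' : Type*} [NormedAddCommGroup E'] [NormedSpace ℝ E']
  {H' : Type*} [TopologicalSpace H'] (J : ModelWithCorners ℝ E' H')
  {N : Type*} [TopologicalSpace N] [ChartedSpace H' N]
  {E : Type*} [NormedAddCommGroup E] [NormedSpace ℝ E]
  {H : Type*} [TopologicalSpace H] (I : ModelWithCorners ℝ E H)
  {M : Type*} [TopologicalSpace M] [ChartedSpace H M]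

/-- `g` is of class `C^n` near `x` and agrees near `x` with `f` on the set `X`. Only the values of
`f` on `X` matter. -/
def IsSmoothExtensionAt (n : WithTop ℕ∞) (X : Set N) (f g : N → M) (x : N) : Prop :=
  ∀ᶠ y in 𝓝 x, ContMDiffAt J I n g y ∧ (y ∈ X → g y = f y)

/-- Smooth extensions of `f` along `X` can be propagated across `L`: if `g` extends `f` near the
points of `X` in a closed set `C`, then `g` can be changed off `C` so as to extend `f` near the
points of `X` in `L` as well. -/
def IsExtendableAcross (n : WithTop ℕ∞) (X : Set N) (f : N → M) (L : Set N) : Prop :=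
  ∀ ⦃C : Set N⦄, IsClosed C → ∀ ⦃g : N → M⦄, (∀ x ∈ X ∩ C, IsSmoothExtensionAt J I n X f g x) →
    ∃ g', EqOn g' g C ∧ ∀ x ∈ X ∩ (C ∪ L), IsSmoothExtensionAt J I n X f g' x

variable {J I}

namespace IsSmoothExtensionAt

variable {n : WithTop ℕ∞} {X : Set N} {f g g₀ : N → M} {x : N}

lemma contMDiffAt (h : IsSmoothExtensionAt J I n X f g x) : ContMDiffAt J I n g x :=
  h.self_of_nhds.1

lemma eq (h : IsSmoothExtensionAt J I n X f g x) (hx : x ∈ X) : g x = f x :=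
  h.self_of_nhds.2 hx

lemma congr {g' : N → M} (h : IsSmoothExtensionAt J I n X f g x) (hg : g' =ᶠ[𝓝 x] g) :
    IsSmoothExtensionAt J I n X f g' x := by
  filter_upwards [h, hg.eventuallyEq_nhds] with y ⟨hsmooth, heq⟩ hgy
  exact ⟨hsmooth.congr_of_eventuallyEq hgy, fun hy ↦ hgy.eq_of_nhds.trans (heq hy)⟩

lemma chartInterpolation [IsManifold I n M] {p : M} {ρ : N → ℝ} {B : Set E} (hB : IsOpen B)
    (hBconvex : Convex ℝ B) (hBtarget : B ⊆ (extChartAt I p).target) (hρ : ContMDiff J 𝓘(ℝ) n ρ)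
    (hρ01 : ∀ y, ρ y ∈ Icc (0 : ℝ) 1) (hg₀ : IsSmoothExtensionAt J I n X f g₀ x)
    (hg : IsSmoothExtensionAt J I n X f g x)
    (hg₀x : g₀ x ∈ (extChartAt I p).source ∩ extChartAt I p ⁻¹' B)
    (hgx : g x ∈ (extChartAt I p).source ∩ extChartAt I p ⁻¹' B) :
    IsSmoothExtensionAt J I n X f (chartInterpolation I p ρ g₀ g) x := by
  have hS := isOpen_extChartAt_preimage' (I := I) p hB
  filter_upwards [hg₀, hg, hg₀.contMDiffAt.continuousAt.eventually_mem (hS.mem_nhds hg₀x),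
    hg.contMDiffAt.continuousAt.eventually_mem (hS.mem_nhds hgx)]
    with y ⟨hg₀y, heq₀⟩ ⟨hgy, heq⟩ hg₀S hgS
  refine ⟨contMDiffAt_chartInterpolation hB hBconvex hBtarget (hρ y) (hρ01 y) hg₀y hgy hg₀S hgS,
    fun hy ↦ ?_⟩
  rw [chartInterpolation_of_eq ((heq₀ hy).trans (heq hy).symm) hgS.1, heq hy]

end IsSmoothExtensionAt

lemma isOpen_setOf_isSmoothExtensionAt {n : WithTop ℕ∞} {X : Set N} {f g : N → M} :
    IsOpen {x | IsSmoothExtensionAt J I n X f g x} :=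
  isOpen_setOfPred_eventually_nhds

namespace IsExtendableAcross

variable {n : WithTop ℕ∞} {X L L' : Set N} {f : N → M}

lemma empty : IsExtendableAcross J I n X f ∅ :=
  fun _ _ g hg ↦ ⟨g, eqOn_refl _ _, by rwa [union_empty]⟩

lemma mono (h : IsExtendableAcross J I n X f L) (hL : L' ⊆ L) :
    IsExtendableAcross J I n X f L' := fun _ hC _ hg ↦
  let ⟨g', hg'g, hg'⟩ := h hC hg
  ⟨g', hg'g, fun x hx ↦ hg' x ⟨hx.1, hx.2.imp_right (hL ·)⟩⟩

lemma union (hL : IsClosed L) (h : IsExtendableAcross J I n X f L)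
    (h' : IsExtendableAcross J I n X f L') : IsExtendableAcross J I n X f (L ∪ L') := by
  intro C hC g hg
  obtain ⟨g₁, hg₁g, hg₁⟩ := h hC hg
  obtain ⟨g₂, hg₂g₁, hg₂⟩ := h' (hC.union hL) hg₁
  exact ⟨g₂, (hg₂g₁.mono subset_union_left).trans hg₁g, by rwa [← union_assoc]⟩

end IsExtendableAcross

section Cutoff

variable [FiniteDimensional ℝ E'] [IsManifold J ∞ N] [T2Space N] [SigmaCompactSpace N]
  {n : ℕ∞} [IsManifold I n M] {X : Set N} {f : N → M}

lemma exists_mem_nhds_isClosed_isExtendableAcross [BoundarylessManifold I M] (hX : IsClosed X)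
    {x : N} (hx : x ∈ X) {g₀ : N → M} (hg₀ : IsSmoothExtensionAt J I n X f g₀ x) :
    ∃ L ∈ 𝓝 x, IsClosed L ∧ IsExtendableAcross J I n X f L := by
  classical
  have := Manifold.locallyCompact_of_finiteDimensional (M := N) J
  obtain ⟨B, hB, hBconvex, hxB, hBtarget⟩ :=
    exists_isOpen_convex_subset_extChartAt_target (I := I) (f x)
  set S : Set M := (extChartAt I (f x)).source ∩ extChartAt I (f x) ⁻¹' B
  have hS : IsOpen S := isOpen_extChartAt_preimage' (f x) hB
  have hg₀x : g₀ x ∈ S := hg₀.eq hx ▸ ⟨mem_extChartAt_source (f x), hxB⟩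
  obtain ⟨L, hL, hLclosed, hLgood⟩ := exists_mem_nhds_isClosed_subset <|
    hg₀.eventually_nhds.and <| hg₀.contMDiffAt.continuousAt.eventually_mem (hS.mem_nhds hg₀x)
  refine ⟨L, hL, hLclosed, fun C hC g hg ↦ ?_⟩
  obtain ⟨ρ, hρ0, hρ1, hρ01⟩ := exists_contMDiffMap_zero_one_nhds_of_isClosed (n := n) J
    (hX.sdiff isOpen_setOf_isSmoothExtensionAt) hC
    (disjoint_left.2 fun y hy hyC ↦ hy.2 (hg y ⟨hy.1, hyC⟩))
  have hgC : ∀ y ∈ C, (fun z ↦ if ρ z = 1 then g z else chartInterpolation I (f x) ρ g₀ g z)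
      =ᶠ[𝓝 y] g := fun y hy ↦ by
    filter_upwards [hρ1.filter_mono (nhds_le_nhdsSet hy)] with z hz using if_pos hz
  refine ⟨_, fun y hy ↦ (hgC y hy).eq_of_nhds, ?_⟩
  rintro y ⟨hyX, hyC | hyL⟩
  · exact (hg y ⟨hyX, hyC⟩).congr (hgC y hyC)
  obtain ⟨hg₀y, hg₀S⟩ : IsSmoothExtensionAt J I n X f g₀ y ∧ g₀ y ∈ S := hLgood hyL
  by_cases hgy : IsSmoothExtensionAt J I n X f g y
  · have hgS : g y ∈ S := by rwa [hgy.eq hyX, ← hg₀y.eq hyX]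
    refine (hg₀y.chartInterpolation hB hBconvex hBtarget ρ.contMDiff hρ01 hgy hg₀S hgS).congr ?_
    filter_upwards [hgy.contMDiffAt.continuousAt.eventually_mem (hS.mem_nhds hgS)] with z hz
    exact ite_eq_right_iff.2 fun hρz ↦ (chartInterpolation_of_eq_one hρz hz.1).symm
  · have hyρ : y ∈ X \ {z | IsSmoothExtensionAt J I n X f g z} := ⟨hyX, hgy⟩
    refine hg₀y.congr ?_
    filter_upwards [hρ0.filter_mono (nhds_le_nhdsSet hyρ),
      hg₀y.contMDiffAt.continuousAt.eventually_mem (hS.mem_nhds hg₀S)] with z hρz hz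
    rw [if_neg (by simp [hρz]), chartInterpolation_of_eq_zero hρz hz.1]

lemma isExtendableAcross_of_isCompact [BoundarylessManifold I M] (hX : IsClosed X)
    (hf : ∀ x ∈ X, ∃ g, IsSmoothExtensionAt J I n X f g x) {K : Set N} (hK : IsCompact K)
    (hKX : K ⊆ X) : IsExtendableAcross J I n X f K := by
  suffices IsExtendableAcross J I n X f (closure K) from this.mono subset_closure
  refine hK.induction_on (p := fun s ↦ IsExtendableAcross J I n X f (closure s)) ?_ ?_ ?_ ?_
  · rw [closure_empty]
    exact .empty
  · exact fun s t hst ht ↦ ht.mono (closure_mono hst)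
  · intro s t hs ht
    rw [closure_union]
    exact .union isClosed_closure hs ht
  · intro x hx
    obtain ⟨g₀, hg₀⟩ := hf x (hKX hx)
    obtain ⟨L, hL, hLclosed, hLext⟩ :=
      exists_mem_nhds_isClosed_isExtendableAcross hX (hKX hx) hg₀
    exact ⟨L, mem_nhdsWithin_of_mem_nhds hL, by rwa [hLclosed.closure_eq]⟩

theorem exists_forall_isSmoothExtensionAt [BoundarylessManifold I M] (hX : IsClosed X)
    (hf : ∀ x ∈ X, ∃ g, IsSmoothExtensionAt J I n X f g x) :
    ∃ g, ∀ x ∈ X, IsSmoothExtensionAt J I n X f g x := by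
  have := Manifold.locallyCompact_of_finiteDimensional (M := N) J
  let K : CompactExhaustion N := (CompactExhaustion.choice N).shiftr
  have step (m : ℕ) (g : N → M) (hg : ∀ x ∈ X ∩ K m, IsSmoothExtensionAt J I n X f g x) :
      ∃ g', EqOn g' g (K m) ∧ ∀ x ∈ X ∩ K (m + 1), IsSmoothExtensionAt J I n X f g' x := by
    obtain ⟨g', hg'g, hg'⟩ := isExtendableAcross_of_isCompact hX hf
      ((K.isCompact (m + 1)).inter_left hX) inter_subset_left (K.isCompact m).isClosed hg
    exact ⟨g', hg'g, fun x hx ↦ hg' x ⟨hx.1, .inr hx⟩⟩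
  choose! next hnext_eq hnext_ext using step
  let G : ℕ → N → M := Nat.rec f next
  have hG_ext : ∀ m, ∀ x ∈ X ∩ K m, IsSmoothExtensionAt J I n X f (G m) x := by
    intro m
    induction m with
    | zero => exact fun x hx ↦ hx.2.elim
    | succ m ih => exact hnext_ext m (G m) ih
  have hG_eq {m l : ℕ} (hml : m ≤ l) : EqOn (G l) (G m) (K m) := by
    induction l, hml using Nat.le_induction with
    | base => exact eqOn_refl _ _
    | succ l hml ih =>
      exact ((hnext_eq l (G l) (hG_ext l)).mono (K.subset hml)).trans ih
  have hlimit (m : ℕ) : EqOn (fun y ↦ G (K.find y) y) (G m) (K m) := fun y hy ↦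
    (hG_eq (K.mem_iff_find_le.1 hy) (K.mem_find y)).symm
  refine ⟨fun y ↦ G (K.find y) y, fun x hx ↦ ?_⟩
  have hxK := K.subset_interior_succ _ (K.mem_find x)
  exact (hG_ext _ x ⟨hx, interior_subset hxK⟩).congr <|
    (hlimit _).eventuallyEq_of_mem (mem_interior_iff_mem_nhds.1 hxK)

end Cutoff

theorem exists_contMDiff_eqOn_of_starConvex {V : Type*} [NormedAddCommGroup V] [NormedSpace ℝ V]
    [FiniteDimensional ℝ V] {n : ℕ∞} [IsManifold I n M] [BoundarylessManifold I M] {X : Set V}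
    (hX : IsClosed X) (hXstar : StarConvex ℝ 0 X) {f : V → M}
    (hf : ∀ x ∈ X, ∃ g, IsSmoothExtensionAt 𝓘(ℝ, V) I n X f g x) :
    ∃ F : V → M, ContMDiff 𝓘(ℝ, V) I n F ∧ EqOn F f X := by
  obtain rfl | ⟨x₀, hx₀⟩ := X.eq_empty_or_nonempty
  · exact ⟨fun _ ↦ f 0, contMDiff_const, eqOn_empty _ _⟩
  obtain ⟨g, hg⟩ := exists_forall_isSmoothExtensionAt hX hf
  set U : Set V := {x | IsSmoothExtensionAt 𝓘(ℝ, V) I n X f g x}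
  set D : Set V := {x | ∀ a ∈ Icc (0 : ℝ) 1, a • x ∈ U}
  have hD : IsOpen D := isOpen_iff_mem_nhds.2 fun x hx ↦
    isCompact_Icc.eventually_forall_of_forall_eventually (P := fun x a ↦ a • x ∈ U) fun a ha ↦
      (continuous_snd.smul continuous_fst).continuousAt.eventually_mem
        (isOpen_setOf_isSmoothExtensionAt.mem_nhds (hx a ha))
  have hXD : X ⊆ D := fun x hx a ha ↦ hg _ (hXstar.smul_mem hx ha.1 ha.2)
  obtain ⟨a, ha0, ha1, ha01⟩ := exists_contMDiffMap_zero_one_nhds_of_isClosed (n := n) 𝓘(ℝ, V)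
    hD.isClosed_compl hX (disjoint_compl_left_iff_subset.2 hXD)
  have hmaps (x : V) : a x • x ∈ U := by
    by_cases hx : x ∈ D
    · exact hx _ (ha01 x)
    · rw [ha0.self_of_nhdsSet x hx, zero_smul]
      exact hg 0 (by simpa using hXstar.smul_mem hx₀ le_rfl zero_le_one)
  have hsmul : ContMDiff 𝓘(ℝ, V) 𝓘(ℝ, V) n fun x ↦ a x • x := a.contMDiff.smul contMDiff_id
  refine ⟨fun x ↦ g (a x • x), fun x ↦ ?_, fun x hx ↦ ?_⟩
  · exact (hmaps x).contMDiffAt.comp (f := fun x ↦ a x • x) x (hsmul x)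
  · simp only [ha1.self_of_nhdsSet x hx, one_smul, (hg x hx).eq hx]

end SmoothExtension

section FixedPoints

open Set Topology Filter Function

variable {ι : Type*} {E : Type*} [NormedAddCommGroup E] [NormedSpace ℝ E]
  {H : Type*} [TopologicalSpace H] {I : ModelWithCorners ℝ E H}
  {M : Type*} [TopologicalSpace M] [ChartedSpace H M]

section Local

variable {E' : Type*} [NormedAddCommGroup E'] [NormedSpace ℝ E']
  {H' : Type*} [TopologicalSpace H'] {J : ModelWithCorners ℝ E' H'}
  {N : Type*} [TopologicalSpace N] [ChartedSpace H' N] {n : WithTop ℕ∞} {x : N}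

lemma IsSmoothExtensionAt.of_extChartAt [IsManifold I n M] [BoundarylessManifold I M]
    {X : Set N} {f : N → M} {h : N → E} (hx : x ∈ X) (hf : ContinuousWithinAt f X x)
    (hh : IsSmoothExtensionAt J 𝓘(ℝ, E) n X (extChartAt I (f x) ∘ f) h x) :
    IsSmoothExtensionAt J I n X f ((extChartAt I (f x)).symm ∘ h) x := by
  have htarget : ∀ᶠ z in 𝓝 (h x), (extChartAt I (f x)).target ∈ 𝓝 z := by
    rw [hh.eq hx]
    exact eventually_mem_nhds_iff.2 (extChartAt_target_mem_nhds_of_boundaryless (f x))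
  have hsource : ∀ᶠ y in 𝓝 x, y ∈ X → f y ∈ (extChartAt I (f x)).source :=
    eventually_nhdsWithin_iff.1 (hf.eventually_mem (extChartAt_source_mem_nhds (f x)))
  filter_upwards [hh, hh.contMDiffAt.continuousAt.eventually htarget, hsource]
    with y ⟨hhy, heq⟩ hy hfy
  refine ⟨((contMDiffOn_extChartAt_symm (f x)).contMDiffAt hy).comp y hhy, fun hyX ↦ ?_⟩
  rw [comp_apply, heq hyX, comp_apply, (extChartAt I (f x)).left_inv (hfy hyX)]

variable [T2Space N] {π : ι → N → N}

lemma exists_isSmoothExtensionAt_biUnion_fixedPoints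
    (hπ : ∀ i, ContMDiff J J n (π i))
    (hππ : ∀ i j, MapsTo (π i) (fixedPoints (π j)) (fixedPoints (π j)))
    {u : N → E} (s : Finset ι)
    (hu : ∀ i ∈ s, π i x = x → ∀ᶠ y in 𝓝 x, ContMDiffAt J 𝓘(ℝ, E) n (u ∘ π i) y) :
    ∃ h, IsSmoothExtensionAt J 𝓘(ℝ, E) n (⋃ i ∈ s, fixedPoints (π i)) u h x := by
  classical
  induction s using Finset.induction_on with
  | empty => exact ⟨0, .of_forall fun y ↦ ⟨contMDiffAt_const, by simp⟩⟩
  | insert i s _ ih =>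
    obtain ⟨h, hh⟩ := ih fun j hj ↦ hu j (Finset.mem_insert_of_mem hj)
    simp only [Finset.set_biUnion_insert]
    by_cases hix : π i x = x
    · have htendsto : Tendsto (π i) (𝓝 x) (𝓝 x) := by
        simpa only [hix] using (hπ i).continuous.tendsto x
      -- The correction term vanishes on the fixed points of the `π j` already dealt with.
      refine ⟨fun y ↦ h y + (u (π i y) - h (π i y)), ?_⟩
      filter_upwards [hh, htendsto.eventually hh, hu i (Finset.mem_insert_self i s) hix]
        with y ⟨hhy, heq⟩ ⟨hhπ, heqπ⟩ huy
      refine ⟨hhy.add (huy.sub (hhπ.comp y (hπ i y))), ?_⟩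
      rintro (hy | hy)
      · rw [hy, add_sub_cancel]
      · have hπy : π i y ∈ ⋃ j ∈ s, fixedPoints (π j) :=
          mapsTo_iUnion_iUnion (fun j ↦ mapsTo_iUnion_iUnion fun _ ↦ hππ i j) hy
        rw [heq hy, heqπ hπy, sub_self, add_zero]
    · refine ⟨h, ?_⟩
      filter_upwards [hh, (isClosed_fixedPoints (hπ i).continuous).isOpen_compl.mem_nhds hix]
        with y ⟨hhy, heq⟩ hy
      exact ⟨hhy, fun hyX ↦ heq (hyX.resolve_left hy)⟩

lemma exists_isSmoothExtensionAt_iUnion_fixedPoints [IsManifold I n M] [BoundarylessManifold I M]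
    [Finite ι] (hπ : ∀ i, ContMDiff J J n (π i))
    (hππ : ∀ i j, MapsTo (π i) (fixedPoints (π j)) (fixedPoints (π j)))
    {f : N → M} (hf : ∀ i, ContMDiff J I n (f ∘ π i))
    (hx : x ∈ ⋃ i, fixedPoints (π i)) :
    ∃ g, IsSmoothExtensionAt J I n (⋃ i, fixedPoints (π i)) f g x := by
  have := Fintype.ofFinite ι
  have hcont : ContinuousOn f (⋃ i, fixedPoints (π i)) :=
    (locallyFinite_of_finite _).continuousOn_iUnion
      (fun i ↦ isClosed_fixedPoints (hπ i).continuous)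
      fun i ↦ (hf i).continuous.continuousOn.congr fun y hy ↦ congrArg f hy.symm
  obtain ⟨h, hh⟩ := exists_isSmoothExtensionAt_biUnion_fixedPoints hπ hππ
      (u := extChartAt I (f x) ∘ f) (x := x) Finset.univ fun i _ hix ↦ by
    have hsource : f (π i x) ∈ (extChartAt I (f x)).source := by
      rw [hix]
      exact mem_extChartAt_source (f x)
    filter_upwards [(hf i).continuous.continuousAt.eventually_mem
      ((isOpen_extChartAt_source (f x)).mem_nhds hsource)] with y hy
    rw [comp_apply, extChartAt_source] at hy
    exact (contMDiffAt_extChartAt' hy).comp (f := f ∘ π i) y (hf i y)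
  exact ⟨_, .of_extChartAt hx (hcont x hx) (by simpa using hh)⟩

end Local

theorem exists_contMDiff_eqOn_fixedPoints {V : Type*} [NormedAddCommGroup V] [NormedSpace ℝ V]
    [FiniteDimensional ℝ V] {n : ℕ∞} [IsManifold I n M] [BoundarylessManifold I M] [Finite ι]
    {π : ι → V →L[ℝ] V} (hππ : ∀ i j, MapsTo (π i) (fixedPoints (π j)) (fixedPoints (π j)))
    {f : V → M} (hf : ∀ i, ContMDiff 𝓘(ℝ, V) I n (f ∘ π i)) :
    ∃ F : V → M, ContMDiff 𝓘(ℝ, V) I n F ∧ ∀ i, EqOn F f (fixedPoints (π i)) := by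
  have hclosed : IsClosed (⋃ i, fixedPoints (π i)) :=
    isClosed_iUnion_of_finite fun i ↦ isClosed_fixedPoints (π i).continuous
  have hstar : StarConvex ℝ 0 (⋃ i, fixedPoints (π i)) := starConvex_iUnion fun i ↦
    starConvex_zero_iff.2 fun v hv a _ _ ↦ by
      rw [mem_fixedPoints, IsFixedPt, map_smul, hv]
  obtain ⟨F, hF, hFf⟩ := exists_contMDiff_eqOn_of_starConvex hclosed hstar fun x hx ↦
    exists_isSmoothExtensionAt_iUnion_fixedPoints (fun i ↦ (π i).contDiff.contMDiff) hππ hf hx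
  exact ⟨F, hF, fun i ↦ hFf.mono (subset_iUnion (fun i ↦ fixedPoints (π i)) i)⟩

end FixedPoints

section CoordinateHyperplanes

open Set Function

variable {ι : Type*} [Fintype ι]

section EraseCoord

variable [DecidableEq ι]

/-- The orthogonal projection of Euclidean space to the hyperplane on which the `i`-th coordinate
vanishes. -/
noncomputable def eraseCoord (i : ι) : EuclideanSpace ℝ ι →L[ℝ] EuclideanSpace ℝ ι :=
  .id ℝ _ - (EuclideanSpace.proj i : EuclideanSpace ℝ ι →L[ℝ] ℝ).smulRight
    (EuclideanSpace.single i (1 : ℝ))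

lemma eraseCoord_apply (i j : ι) (v : EuclideanSpace ℝ ι) :
    eraseCoord i v j = if j = i then 0 else v j := by
  by_cases h : j = i
  · subst h; simp [eraseCoord]
  · simp [eraseCoord, h]

lemma mem_fixedPoints_eraseCoord {i : ι} {v : EuclideanSpace ℝ ι} :
    v ∈ fixedPoints (eraseCoord i) ↔ v i = 0 := by
  refine ⟨fun h ↦ ?_, fun h ↦ ?_⟩
  · rw [← h, eraseCoord_apply, if_pos rfl]
  · ext j
    rw [eraseCoord_apply]
    split_ifs with hj
    · rw [hj, h]
    · rfl

lemma mapsTo_eraseCoord (i j : ι) :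
    MapsTo (eraseCoord i) (fixedPoints (eraseCoord j)) (fixedPoints (eraseCoord j)) := by
  intro v hv
  rw [mem_fixedPoints_eraseCoord] at hv ⊢
  rw [eraseCoord_apply, hv, ite_self]

end EraseCoord

theorem exists_contMDiff_eq_on_coordinate_hyperplanes {E : Type*} [NormedAddCommGroup E]
    [NormedSpace ℝ E] {H : Type*} [TopologicalSpace H] {I : ModelWithCorners ℝ E H}
    {M : Type*} [TopologicalSpace M] [ChartedSpace H M] {n : ℕ∞} [IsManifold I n M]
    [BoundarylessManifold I M] {κ : Type*} [Finite κ] [Nonempty κ] {c : κ → ι}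
    {g : κ → EuclideanSpace ℝ ι → M} (hg : ∀ j, ContMDiff 𝓘(ℝ, EuclideanSpace ℝ ι) I n (g j))
    (hgg : ∀ i j v, v (c i) = 0 → v (c j) = 0 → g i v = g j v) :
    ∃ F : EuclideanSpace ℝ ι → M, ContMDiff 𝓘(ℝ, EuclideanSpace ℝ ι) I n F ∧
      ∀ j v, v (c j) = 0 → F v = g j v := by
  classical
  have hface : ∀ v : EuclideanSpace ℝ ι, ∃ j, ∀ i, v (c i) = 0 → v (c j) = 0 := fun v ↦ by
    by_cases h : ∃ j, v (c j) = 0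
    · exact h.imp fun _ hj _ _ ↦ hj
    · exact ⟨Classical.arbitrary κ, fun i hi ↦ (h ⟨i, hi⟩).elim⟩
  choose face hface using hface
  have hf (j : κ) (v : EuclideanSpace ℝ ι) (hv : v (c j) = 0) : g (face v) v = g j v :=
    hgg _ _ v (hface v j hv) hv
  obtain ⟨F, hF, hFf⟩ := exists_contMDiff_eqOn_fixedPoints (I := I) (π := fun j ↦ eraseCoord (c j))
      (f := fun v ↦ g (face v) v) (fun i j ↦ mapsTo_eraseCoord (c i) (c j)) fun j ↦ by
    refine ((hg j).comp (eraseCoord (c j)).contDiff.contMDiff).congr fun v ↦ hf j _ ?_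
    rw [eraseCoord_apply, if_pos rfl]
  exact ⟨F, hF, fun j v hv ↦ (hFf j (mem_fixedPoints_eraseCoord.2 hv)).trans (hf j v hv)⟩

end CoordinateHyperplanes

section Horns

open Simplicial

instance isSplitMono_δ {n : ℕ} (j : Fin (n + 2)) : IsSplitMono (SimplexCategory.δ j) :=
  .mk' ((SimplexCategoryGenRel.splitMonoδ j).map SimplexCategoryGenRel.toSimplexCategory)

namespace AffineSimplex

lemma map_comp_apply {n m k : SimplexCategory} (f : n ⟶ m) (g : m ⟶ k) (x : AffineSimplex n) :
    map (f ≫ g) x = map g (map f x) :=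
  congrFun (map_comp f g) x

section Face

variable {n : ℕ} (j : Fin (n + 2))

lemma map_δ_apply_self (x : AffineSimplex ⦋n⦌) : (map (SimplexCategory.δ j) x).1 j = 0 := by
  simp [map_apply, SimplexCategory.coe_δ, Fin.succAbove_ne]

lemma map_δ_apply_succAbove (x : AffineSimplex ⦋n⦌) (a : Fin (n + 1)) :
    (map (SimplexCategory.δ j) x).1 (j.succAbove a) = x.1 a := by
  simp [map_apply, SimplexCategory.coe_δ]

lemma map_δ_injective : Function.Injective (map (SimplexCategory.δ j)) := by
  intro x y hxy
  apply Subtype.ext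
  ext a
  rw [← map_δ_apply_succAbove j, hxy, map_δ_apply_succAbove]

variable {j}

lemma exists_map_δ_eq {p : AffineSimplex ⦋n + 1⦌} (hp : p.1 j = 0) :
    ∃ x, map (SimplexCategory.δ j) x = p := by
  have hsum : ∑ a, p.1 (j.succAbove a) = 1 := by
    have hp1 := p.2
    rwa [Fin.sum_univ_succAbove _ j, hp, zero_add] at hp1
  refine ⟨⟨WithLp.toLp 2 fun a ↦ p.1 (j.succAbove a), hsum⟩, ?_⟩
  apply Subtype.ext
  ext b
  obtain rfl | ⟨a, rfl⟩ := j.eq_self_or_eq_succAbove b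
  · exact (map_δ_apply_self b _).trans hp.symm
  · exact map_δ_apply_succAbove j _ a

end Face

/-- The projection of `ℝⁿ⁺¹` to `𝔸ⁿ` along the `k`-th coordinate axis. -/
noncomputable def projAlong {n : SimplexCategory} (k : Fin (n.len + 1))
    (v : EuclideanSpace ℝ (Fin (n.len + 1))) : AffineSimplex n :=
  ⟨v + (1 - ∑ i, v i) • EuclideanSpace.single k 1, by simp [Finset.sum_add_distrib]⟩

variable {n : SimplexCategory} {k : Fin (n.len + 1)}

lemma projAlong_apply_of_ne {i : Fin (n.len + 1)} (hi : i ≠ k)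
    (v : EuclideanSpace ℝ (Fin (n.len + 1))) : (projAlong k v).1 i = v i := by
  simp [projAlong, hi]

lemma projAlong_val (x : AffineSimplex n) : projAlong k x.1 = x := by
  apply Subtype.ext
  simp [projAlong, x.2]

lemma isPlot_projAlong : IsPlot (projAlong (n := n) k) := by
  change ContDiff ℝ ∞ fun v : EuclideanSpace ℝ (Fin (n.len + 1)) ↦
    v + (1 - ∑ i, v i) • EuclideanSpace.single k (1 : ℝ)
  fun_prop

end AffineSimplex

namespace smoothSing

variable {X : Type u} [DiffeologicalSpace X]

/-- The Yoneda bijection between maps from a standard simplex to `S^D(X)` and smooth maps from the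
affine simplex to `X`. -/
def homEquiv {n : SimplexCategory} :
    (SSet.stdSimplex.obj n ⟶ smoothSing X) ≃ {σ : AffineSimplex n → X // DSmooth σ} :=
  SSet.yonedaEquiv

lemma homEquiv_δ_comp {n : ℕ} (j : Fin (n + 2)) (φ : Δ[n + 1] ⟶ smoothSing X)
    (x : AffineSimplex ⦋n⦌) :
    (homEquiv (SSet.stdSimplex.δ j ≫ φ)).1 x =
      (homEquiv φ).1 (AffineSimplex.map (SimplexCategory.δ j) x) :=
  congrFun (congrArg Subtype.val (SSet.stdSimplex.yonedaEquiv_δ_comp φ j)) x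

lemma homEquiv_eq_of_isCompatible_of_lt {n : ℕ} {k : Fin (n + 3)}
    {f : ∀ j : Fin (n + 3), j ≠ k → (Δ[n + 1] ⟶ smoothSing X)} (hf : SSet.horn.IsCompatible f)
    {i j : Fin (n + 3)} (hi : i ≠ k) (hj : j ≠ k) (hij : i < j) {p q : AffineSimplex ⦋n + 1⦌}
    (hpq : AffineSimplex.map (SimplexCategory.δ i) p = AffineSimplex.map (SimplexCategory.δ j) q) :
    (homEquiv (f i hi)).1 p = (homEquiv (f j hj)).1 q := by
  obtain ⟨i, rfl⟩ := i.eq_castSucc_of_ne_last (Fin.ne_last_of_lt hij)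
  obtain ⟨j, rfl⟩ := j.eq_succ_of_ne_zero (Fin.ne_zero_of_lt hij)
  have hle : i ≤ j := Fin.castSucc_lt_succ_iff.1 hij
  have hqi : q.1 i = 0 := by
    rw [← AffineSimplex.map_δ_apply_succAbove j.succ, ← hpq,
      Fin.succAbove_succ_of_le _ _ hle, AffineSimplex.map_δ_apply_self]
  obtain ⟨r, rfl⟩ := AffineSimplex.exists_map_δ_eq hqi
  rw [← AffineSimplex.map_comp_apply, SimplexCategory.δ_comp_δ hle,
    AffineSimplex.map_comp_apply] at hpq
  obtain rfl := AffineSimplex.map_δ_injective _ hpq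
  have hfij := hf.δ_pred_comp i.castSucc j.succ hi hj hij
  rw [Fin.pred_succ, Fin.castPred_castSucc] at hfij
  rw [← homEquiv_δ_comp, hfij, homEquiv_δ_comp]

lemma homEquiv_eq_of_isCompatible {n : ℕ} {k : Fin (n + 2)}
    {f : ∀ j : Fin (n + 2), j ≠ k → (Δ[n] ⟶ smoothSing X)} (hf : SSet.horn.IsCompatible f)
    {i j : Fin (n + 2)} (hi : i ≠ k) (hj : j ≠ k) {p q : AffineSimplex ⦋n⦌}
    (hpq : AffineSimplex.map (SimplexCategory.δ i) p = AffineSimplex.map (SimplexCategory.δ j) q) :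
    (homEquiv (f i hi)).1 p = (homEquiv (f j hj)).1 q := by
  obtain rfl | hij := eq_or_ne i j
  · rw [AffineSimplex.map_δ_injective i hpq]
  obtain _ | n := n
  · omega
  obtain hij | hji := hij.lt_or_gt
  · exact homEquiv_eq_of_isCompatible_of_lt hf hi hj hij hpq
  · exact (homEquiv_eq_of_isCompatible_of_lt hf hj hi hji hpq.symm).symm

end smoothSing

open AffineSimplex smoothSing in
theorem kanComplex_smoothSing_of_hyperplane_extension {X : Type u} [DiffeologicalSpace X]
    (hX : ∀ (n : ℕ) (k : Fin (n + 2)) (g : {j // j ≠ k} → EuclideanSpace ℝ (Fin (n + 2)) → X),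
      (∀ j, IsPlot (g j)) → (∀ i j v, v i.1 = 0 → v j.1 = 0 → g i v = g j v) →
      ∃ F : EuclideanSpace ℝ (Fin (n + 2)) → X, IsPlot F ∧ ∀ j v, v j.1 = 0 → F v = g j v) :
    SSet.KanComplex (smoothSing X) := by
  refine SSet.KanComplex.iff.2 fun n k f hf ↦ ?_
  let g (j : {j // j ≠ k}) (v : EuclideanSpace ℝ (Fin (n + 2))) : X :=
    (homEquiv (f j j.2)).1 (map (retraction (SimplexCategory.δ j.1)) (projAlong (n := ⦋n + 1⦌) k v))
  have hg_plot (j : {j // j ≠ k}) : IsPlot (g j) :=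
    ((homEquiv (f j j.2)).2.comp (dSmooth_map _)) _ _ isPlot_projAlong
  have hg (j : {j // j ≠ k}) {v : EuclideanSpace ℝ (Fin (n + 2))} {x : AffineSimplex ⦋n⦌}
      (hx : map (SimplexCategory.δ j.1) x = projAlong k v) :
      g j v = (homEquiv (f j j.2)).1 x := by
    simp only [g, ← hx, ← map_comp_apply, IsSplitMono.id, map_id, id]
  have hface (j : {j // j ≠ k}) {v : EuclideanSpace ℝ (Fin (n + 2))} (hv : v j.1 = 0) :
      ∃ x : AffineSimplex ⦋n⦌, map (SimplexCategory.δ j.1) x = projAlong k v :=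
    exists_map_δ_eq ((projAlong_apply_of_ne j.2 v).trans hv)
  obtain ⟨F, hF, hFg⟩ := hX n k g hg_plot fun i j v hi hj ↦ by
    obtain ⟨x, hx⟩ := hface i hi
    obtain ⟨y, hy⟩ := hface j hj
    rw [hg i hx, hg j hy, homEquiv_eq_of_isCompatible hf i.2 j.2 (hx.trans hy.symm)]
  have hF_smooth : DSmooth fun x : AffineSimplex ⦋n + 1⦌ ↦ F x.1 :=
    fun _ _ hp ↦ isPlot_reparam hF hp
  refine ⟨homEquiv.symm ⟨_, hF_smooth⟩, fun j hj ↦ homEquiv.injective <|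
    Subtype.ext <| funext fun x ↦ ?_⟩
  rw [homEquiv_δ_comp, Equiv.apply_symm_apply]
  exact (hFg ⟨j, hj⟩ _ (map_δ_apply_self j x)).trans (hg ⟨j, hj⟩ (projAlong_val _).symm)

end Horns

theorem mainTheorem4_general {E : Type*} [NormedAddCommGroup E] [NormedSpace ℝ E]
    {H : Type*} [TopologicalSpace H] (I : ModelWithCorners ℝ E H)
    (M : Type*) [TopologicalSpace M] [ChartedSpace H M] [IsManifold I ∞ M]
    [BoundarylessManifold I M] :
    (I.diffeology M).IsFibrant := by
  let := I.diffeology M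
  refine kanComplex_smoothSing_of_hyperplane_extension fun n k g hg hgg ↦ ?_
  have : Nonempty {j // j ≠ k} := nonempty_subtype.2 (exists_ne k)
  exact exists_contMDiff_eq_on_coordinate_hyperplanes (n := ⊤) hg hgg

theorem mainTheorem4 {E : Type*} [NormedAddCommGroup E] [NormedSpace ℝ E] [FiniteDimensional ℝ E]
    {H : Type*} [TopologicalSpace H] (I : ModelWithCorners ℝ E H)
    (M : Type*) [TopologicalSpace M] [ChartedSpace H M] [IsManifold I ∞ M]
    [BoundarylessManifold I M] [T2Space M] [SecondCountableTopology M] :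
    (I.diffeology M).IsFibrant :=
  mainTheorem4_general I M
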